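/- Write points of $\mathbb{C}^3\times\mathbb{C}^2\cong\mathbb{C}^5$ as $(a,b,c;d,e)$, with upper parameters $a,b,c$ and lower parameters $d,e$. Let ${}_3F_2(a,b,c;d,e)=\sum_{k\ge0}\frac{(a)_k(b)_k(c)_k}{(d)_k(e)_k\,k!}$, where $(a)_k=a(a+1)\cdots(a+k-1)$. Call $(a,b,c;d,e)$ admissible if neither $d$ nor $e$ is a non-positive integer and $\operatorname{Re}(d+e-a-b-c)>0$. Put $\Gamma\bigl[{p_1,\dots,p_m\atop q_1,\dots,q_n}\bigr]=\prod_i\Gamma(p_i)/\prod_j\Gamma(q_j)$ (a gamma quotient), interpreted as zero if some $q_j$ is a non-positive integer. A set $\mathcal V\subset\mathbb{C}^3\times\mathbb{C}^2$ has the *gamma quotient summation property* if there are affine functions $p_1,\dots,p_m,q_1,\dots,q_n$ of $(a,b,c;d,e)$ with rational coefficients such that, at every admissible point of $\mathcal V$, no $p_i$ takes a non-positive integer value and the series ${}_3F_2(a,b,c;d,e)$ converges to $\Gamma\bigl[{p_1,\dots,p_m\atop q_1,\dots,q_n}\bigr]$. The *Thomae group* $\mathfrak T\subset GL(5,\mathbb{C})$,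 isomorphic to $S_5$, consists of the linear maps of $\mathbb{C}^3\times\mathbb{C}^2$ that permute the coordinates $(x,y,z;u,v)$ defined by $a=x+u+v$, $b=y+u+v$, $c=z+u+v$, $d=x+y+z+2u+v$, $e=x+y+z+u+2v$. It contains the group $S_3\times S_2$ of separate permutations of the upper parameters $a,b,c$ and the lower parameters $d,e$. The *Slater variety* (for $r=2$) is the set of all $(\alpha_1,\alpha_2,\alpha_3;\beta_1+1,\beta_2+1)$ with $\alpha_1+\alpha_2+\alpha_3=\beta_1+\beta_2$ and $\alpha_1\alpha_2+\alpha_1\alpha_3+\alpha_2\alpha_3=\beta_1\beta_2$. **Theorem.** Every set in the $\mathfrak T$-orbit of the Slater variety is an irreducible algebraic variety of dimension $3$, is not a $3$-plane ($3$-dimensional affine subspace), and has the gamma quotient summation property. Up to separate permutations of upper and lower parameters, the orbit comprises exactly three varieties: the following three varieties lie on it, and each variety on it is equivalent under $S_3\times S_2$ to exactly one of them. * $\mathcal V_1$: $ab+bc+ca=(d-1)(e-1)$ and $d+e-a-b-c=2$ (this is the Slater variety itself); * $\mathcal V_2$: $(a-1)(b-1)=[(a-1)+(b-1)-(e-1)]\,c$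 and $d=c+2$; * $\mathcal V_3$: $(a-1)(b-1)=(d-2)(e-2)$ and $c=2$. They correspond to the following identities, in each of which it is assumed that no lower parameter is a non-positive integer, and in each of which the series converges. 1. If $ab+bc+ca=(d-1)(e-1)$ and $d+e-a-b-c=2$, then $${}_3F_2\left({a,\,b,\,c\atop d,\,e}\right)=\Gamma\left[{d,\ e\atop a+1,\ b+1,\ c+1}\right].$$ 2. If $(a-1)(b-1)=[(a-1)+(b-1)-(e-1)]\,c$ and $\operatorname{Re}(e-a-b+2)>0$, then $${}_3F_2\left({a,\,b,\,c\atop c+2,\,e}\right)=\Gamma\left[{e,\ e-a-b+2,\ c+2\atop e-a+1,\ e-b+1,\ c+1}\right].$$ 3. If $(a-1)(b-1)=(d-2)(e-2)$ and $\operatorname{Re}(d+e-a-b-2)>0$, then $${}_3F_2\left({a,\,b,\,2\atop d,\,e}\right)=\frac{(d-1)(e-1)}{d+e-a-b-2}.$$ -/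

import Mathlib

open scoped Pointwise

noncomputable section

/-! Parameter vectors `(a, b, c; d, e) ∈ ℂ³ × ℂ²` are functions `v : Fin 5 → ℂ`: the coordinates
`0, 1, 2` are the upper parameters `a, b, c`, and `3, 4` are the lower parameters `d, e`. -/

/-- The `k`-th term of the series `₃F₂(a, b, c; d, e; 1)`. -/
def hyp3F2Term (a b c d e : ℂ) (k : ℕ) : ℂ :=
  ((ascPochhammer ℂ k).eval a * (ascPochhammer ℂ k).eval b * (ascPochhammer ℂ k).eval c) /
    ((ascPochhammer ℂ k).eval d * (ascPochhammer ℂ k).eval e * (k.factorial : ℂ))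

/-- `z` is not one of `0, -1, -2, …`. -/
def NotNonposInt (z : ℂ) : Prop := ∀ n : ℕ, z ≠ -(n : ℂ)

/-- The gamma quotient `Γ[num; den] = ∏ Γ(num) / ∏ Γ(den)`. As `Complex.Gamma` vanishes by
convention at the poles of the gamma function, the quotient is zero if an entry of `den` is a
non-positive integer, which is the usual interpretation. -/
def gammaQuotient (num den : List ℂ) : ℂ :=
  (num.map Complex.Gamma).prod / (den.map Complex.Gamma).prod

/-- Affine functions on `ℂ³ × ℂ²` with rational coefficients: `(q, q₀)` stands for
`v ↦ ∑ i, q i * v i + q₀`. -/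
abbrev RatAffine : Type := (Fin 5 → ℚ) × ℚ

/-- The value of an affine function with rational coefficients. -/
def RatAffine.eval (f : RatAffine) (v : Fin 5 → ℂ) : ℂ :=
  ∑ i, (f.1 i : ℂ) * v i + (f.2 : ℂ)

/-- The parameter vectors at which `₃F₂(a, b, c; d, e; 1)` is a well-defined convergent series:
no lower parameter is a non-positive integer and the parametric excess has positive real part. -/
def Admissible (v : Fin 5 → ℂ) : Prop :=
  NotNonposInt (v 3) ∧ NotNonposInt (v 4) ∧ 0 < (v 3 + v 4 - v 0 - v 1 - v 2).re

/-- The gamma quotient summation property of a set of parameter vectors: on its admissible points,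
`₃F₂(a, b, c; d, e; 1)` is a gamma quotient whose arguments are fixed affine functions of
`a, b, c, d, e` with rational coefficients (the gamma functions in the numerator being finite). -/
def HasGammaQuotientSummation (V : Set (Fin 5 → ℂ)) : Prop :=
  ∃ num den : List RatAffine, ∀ v ∈ V, Admissible v →
    (∀ f ∈ num, NotNonposInt (f.eval v)) ∧
    HasSum (hyp3F2Term (v 0) (v 1) (v 2) (v 3) (v 4))
      (gammaQuotient (num.map fun f => f.eval v) (den.map fun f => f.eval v))

/-- `V` is an irreducible algebraic variety in affine `5`-space, of dimension `n`: it is the common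
zero set of a collection of polynomials, its ideal is prime, and its coordinate ring has Krull
dimension `n`. -/
def IsVarietyOfDim (V : Set (Fin 5 → ℂ)) (n : ℕ) : Prop :=
  (∃ S : Set (MvPolynomial (Fin 5) ℂ), V = {v | ∀ p ∈ S, MvPolynomial.eval v p = 0}) ∧
  (MvPolynomial.vanishingIdeal ℂ V).IsPrime ∧
  ringKrullDim (MvPolynomial (Fin 5) ℂ ⧸ MvPolynomial.vanishingIdeal ℂ V) = n

/-- `V` is an `n`-plane, i.e. an `n`-dimensional affine subspace. -/
def IsPlaneOfDim (V : Set (Fin 5 → ℂ)) (n : ℕ) : Prop :=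
  ∃ P : AffineSubspace ℂ (Fin 5 → ℂ),
    (P : Set (Fin 5 → ℂ)).Nonempty ∧ Module.finrank ℂ P.direction = n ∧ (P : Set (Fin 5 → ℂ)) = V

/-! ### The Thomae group -/

/-- The matrix `A` with `(a, b, c; d, e) = (x, y, z; u, v) A`. -/
def thomaeMatrix : Matrix (Fin 5) (Fin 5) ℂ :=
  !![1, 0, 0, 1, 1;
     0, 1, 0, 1, 1;
     0, 0, 1, 1, 1;
     1, 1, 1, 2, 1;
     1, 1, 1, 1, 2]

/-- The inverse of `thomaeMatrix`. -/
def thomaeMatrixInv : Matrix (Fin 5) (Fin 5) ℂ :=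
  (1 / 3 : ℂ) • !![ 1, -2, -2,  1,  1;
                   -2,  1, -2,  1,  1;
                   -2, -2,  1,  1,  1;
                    1,  1,  1,  1, -2;
                    1,  1,  1, -2,  1]

theorem thomaeMatrix_mul_inv : thomaeMatrix * thomaeMatrixInv = 1 := by
  ext i j
  fin_cases i <;> fin_cases j <;>
    simp [thomaeMatrix, thomaeMatrixInv, Matrix.mul_apply, Fin.sum_univ_five] <;> norm_num

theorem thomaeMatrixInv_mul : thomaeMatrixInv * thomaeMatrix = 1 := by
  ext i j
  fin_cases i <;> fin_cases j <;>
    simp [thomaeMatrix, thomaeMatrixInv, Matrix.mul_apply, Fin.sum_univ_five] <;> norm_num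

/-- The linear change of coordinates `(x, y, z; u, v) ↦ (a, b, c; d, e) = (x, y, z; u, v) A`. -/
def thomaeCoord : (Fin 5 → ℂ) ≃ₗ[ℂ] (Fin 5 → ℂ) :=
  Matrix.toLinearEquivRight'OfInv thomaeMatrixInv_mul thomaeMatrix_mul_inv

/-- The representation of `S₅` on `ℂ⁵` by permutation of the coordinates. -/
def permRep : Equiv.Perm (Fin 5) →* ((Fin 5 → ℂ) ≃ₗ[ℂ] (Fin 5 → ℂ)) where
  toFun σ := LinearEquiv.funCongrLeft ℂ ℂ σ⁻¹
  map_one' := rfl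
  map_mul' _ _ := rfl

/-- The representation of `S₅` on the space of parameters `(a, b, c; d, e)` that permutes the
Thomae coordinates `(x, y, z; u, v)`. -/
def thomaeRep : Equiv.Perm (Fin 5) →* ((Fin 5 → ℂ) ≃ₗ[ℂ] (Fin 5 → ℂ)) :=
  (MulAut.conj thomaeCoord).toMonoidHom.comp permRep

/-- The Thomae group, a subgroup of `GL(5, ℂ)` isomorphic to `S₅`. -/
def thomaeGroup : Subgroup ((Fin 5 → ℂ) ≃ₗ[ℂ] (Fin 5 → ℂ)) := thomaeRep.range

/-- The group `S₃ × S₂` of separate permutations of the upper parameters `(a, b, c)` and of the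
lower parameters `(d, e)`. -/
def sepPermGroup : Subgroup ((Fin 5 → ℂ) ≃ₗ[ℂ] (Fin 5 → ℂ)) :=
  (MulAction.stabilizer (Equiv.Perm (Fin 5)) ({0, 1, 2} : Set (Fin 5))).map permRep

/-! ### The varieties -/

/-- The variety `U_r ⊆ ℂ^(r+1) × ℂ^r` on which the `k`-th elementary symmetric polynomials of the
upper and of the lower parameters agree, `k = 1, …, r`. -/
def symmetricVariety (r : ℕ) : Set ((Fin (r + 1) → ℂ) × (Fin r → ℂ)) :=
  {p | ∀ k : ℕ, 1 ≤ k → k ≤ r →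
    ∑ s ∈ Finset.powersetCard k Finset.univ, ∏ i ∈ s, p.1 i =
      ∑ s ∈ Finset.powersetCard k Finset.univ, ∏ j ∈ s, p.2 j}

/-- The Slater variety for `r = 2`: all `(α₁, α₂, α₃; β₁ + 1, β₂ + 1)` with `(α; β) ∈ U₂`. -/
def slaterVariety : Set (Fin 5 → ℂ) :=
  {v | ((![v 0, v 1, v 2], ![v 3 - 1, v 4 - 1]) : (Fin 3 → ℂ) × (Fin 2 → ℂ)) ∈ symmetricVariety 2}

/-- `ab + bc + ca = (d - 1)(e - 1)` and `d + e - a - b - c = 2`. -/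
def varietyI : Set (Fin 5 → ℂ) :=
  {v | v 0 * v 1 + v 1 * v 2 + v 2 * v 0 = (v 3 - 1) * (v 4 - 1) ∧
    v 3 + v 4 - v 0 - v 1 - v 2 = 2}

/-- `(a - 1)(b - 1) = [(a - 1) + (b - 1) - (e - 1)] c` and `d = c + 2`. -/
def varietyII : Set (Fin 5 → ℂ) :=
  {v | (v 0 - 1) * (v 1 - 1) = ((v 0 - 1) + (v 1 - 1) - (v 4 - 1)) * v 2 ∧ v 3 = v 2 + 2}

/-- `(a - 1)(b - 1) = (d - 2)(e - 2)` and `c = 2`. -/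
def varietyIII : Set (Fin 5 → ℂ) :=
  {v | (v 0 - 1) * (v 1 - 1) = (v 3 - 2) * (v 4 - 2) ∧ v 2 = 2}

end

open Filter Topology MvPolynomial

noncomputable section

/-! Two independent facts carry the theorem. Analytic: on each variety the quadratic relation makes
the series telescope. In identities 1 and 3 the partial sums are closed expressions in a single term
of a neighbouring series (`hasSum_hyp3F2Term_of_slater`, `hasSum_hyp3F2Term_two`); in identity 2 the
difference from `c + 1` times a Gauss series telescopes to zero (`hasSum_hyp3F2Term_add_two`, with
Gauss's theorem `hasSum_gauss`). The limits come from Euler's formula: the terms behave like a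
constant times a power of `n` with exponent `-1` minus the excess. Geometric: in Thomae coordinates
the Slater variety is cut out by equations involving only power sums over all five coordinates and
over the subset `{0, 1, 2}` (`thomaeVariety`). Its image under a permutation therefore depends only
on the image of that subset, so the orbit is indexed by the 3-subsets of five points. Under `S₃ ×
S₂` these fall into three classes, according to whether they meet `{0, 1, 2}` in 3, 2 or 1 points;
these are the three varieties. Dimension, irreducibility and non-planarity are invariant under
linear automorphisms, so they are checked on `varietyIII` alone, which is the quadric of singular
2×2 matrices. -/

/-! ### Rising factorials, asymptotics of the terms, convergence. -/

theorem NotNonposInt.Gamma_ne_zero {z : ℂ} (hz : NotNonposInt z) : Complex.Gamma z ≠ 0 :=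
  Complex.Gamma_ne_zero hz

theorem NotNonposInt.of_re_pos {z : ℂ} (hz : 0 < z.re) : NotNonposInt z := by
  rintro n rfl
  simp only [Complex.neg_re, Complex.natCast_re] at hz
  linarith [(n.cast_nonneg : (0 : ℝ) ≤ n)]

theorem NotNonposInt.add_natCast_ne_zero {z : ℂ} (hz : NotNonposInt z) (n : ℕ) :
    z + n ≠ 0 := fun h => hz n (eq_neg_of_add_eq_zero_left h)

theorem NotNonposInt.add_natCast {z : ℂ} (hz : NotNonposInt z) (n : ℕ) :
    NotNonposInt (z + n) := by
  intro m h
  refine hz (m + n) ?_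
  push_cast
  linear_combination h

theorem NotNonposInt.ascPochhammer_ne_zero {z : ℂ} (hz : NotNonposInt z) (n : ℕ) :
    (ascPochhammer ℂ n).eval z ≠ 0 := by
  induction n with
  | zero => simp
  | succ n ih =>
    rw [ascPochhammer_succ_eval]
    exact mul_ne_zero ih (hz.add_natCast_ne_zero n)

theorem ascPochhammer_eval_eq_prod_range (n : ℕ) (z : ℂ) :
    (ascPochhammer ℂ n).eval z = ∏ j ∈ Finset.range n, (z + j) := by
  induction n with
  | zero => simp
  | succ n ih => rw [ascPochhammer_succ_eval, Finset.prod_range_succ, ih]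

theorem ascPochhammer_eval_succ_left (n : ℕ) (z : ℂ) :
    (ascPochhammer ℂ (n + 1)).eval z = z * (ascPochhammer ℂ n).eval (z + 1) := by
  rw [ascPochhammer_succ_left]
  simp [Polynomial.eval_comp]

/-- `(z)ₖ (z + k) = z (z + 1)ₖ`. -/
theorem ascPochhammer_eval_mul_add (n : ℕ) (z : ℂ) :
    (ascPochhammer ℂ n).eval z * (z + n) = z * (ascPochhammer ℂ n).eval (z + 1) := by
  rw [← ascPochhammer_succ_eval, ascPochhammer_eval_succ_left]

/-- Euler's limit formula for the reciprocal of the gamma function. -/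
theorem tendsto_ascPochhammer_inv_Gamma (z : ℂ) :
    Tendsto (fun n : ℕ => (ascPochhammer ℂ (n + 1)).eval z / ((n : ℂ) ^ z * n.factorial))
      atTop (𝓝 (Complex.Gamma z)⁻¹) := by
  by_cases hz : NotNonposInt z
  · refine ((Complex.GammaSeq_tendsto_Gamma z).inv₀ hz.Gamma_ne_zero).congr fun n => ?_
    rw [Complex.GammaSeq, inv_div, ascPochhammer_eval_eq_prod_range]
  · simp only [NotNonposInt, not_forall, not_not] at hz
    obtain ⟨m, rfl⟩ := hz
    -- At a pole `Complex.Gamma` is 0, so the claimed limit is 0; the sequence vanishes from `n = m`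
    -- on, since the rising factorial then contains the factor `-m + m`.
    rw [Complex.Gamma_neg_nat_eq_zero, inv_zero]
    refine tendsto_const_nhds.congr' ?_
    filter_upwards [eventually_ge_atTop m] with n hn
    rw [ascPochhammer_eval_neg_coe_nat_of_lt (by omega), zero_div]

/-- The asymptotic behaviour of the terms of the series `₃F₂(a, b, c; d, e; 1)`. -/
theorem tendsto_hyp3F2Term_mul_cpow {d e : ℂ} (a b c : ℂ) (hd : NotNonposInt d)
    (he : NotNonposInt e) :
    Tendsto (fun n : ℕ => hyp3F2Term a b c d e (n + 1) * (n : ℂ) ^ (d + e + 1 - a - b - c)) atTop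
      (𝓝 (Complex.Gamma d * Complex.Gamma e /
        (Complex.Gamma a * Complex.Gamma b * Complex.Gamma c))) := by
  have h1 : NotNonposInt 1 := .of_re_pos (by simp)
  -- The factor with parameter 1 accounts for the factorial in the denominator of the term.
  have key := (((tendsto_ascPochhammer_inv_Gamma a).mul (tendsto_ascPochhammer_inv_Gamma b)).mul
    (tendsto_ascPochhammer_inv_Gamma c)).div
    (((tendsto_ascPochhammer_inv_Gamma d).mul (tendsto_ascPochhammer_inv_Gamma e)).mul
      (tendsto_ascPochhammer_inv_Gamma 1))
    (mul_ne_zero (mul_ne_zero (inv_ne_zero hd.Gamma_ne_zero) (inv_ne_zero he.Gamma_ne_zero))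
      (inv_ne_zero h1.Gamma_ne_zero))
  refine (key.congr' ?_).trans_eq ?_
  · filter_upwards [eventually_ge_atTop 1] with n hn
    have hn0 : (n : ℂ) ≠ 0 := by exact_mod_cast (by omega : n ≠ 0)
    have hp : ∀ w : ℂ, (n : ℂ) ^ w ≠ 0 := fun w => by simp [Complex.cpow_eq_zero_iff, hn0]
    have hf : (n.factorial : ℂ) ≠ 0 := by exact_mod_cast n.factorial_ne_zero
    have hf' : ((n + 1).factorial : ℂ) ≠ 0 := by exact_mod_cast (n + 1).factorial_ne_zero
    have hd' := hd.ascPochhammer_ne_zero (n + 1)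
    have he' := he.ascPochhammer_ne_zero (n + 1)
    have := hp a
    have := hp b
    have := hp c
    have := hp d
    have := hp e
    have := hp 1
    simp only [hyp3F2Term, Pi.div_apply]
    rw [ascPochhammer_eval_one, Complex.cpow_sub _ _ hn0, Complex.cpow_sub _ _ hn0,
      Complex.cpow_sub _ _ hn0, Complex.cpow_add _ _ hn0, Complex.cpow_add _ _ hn0]
    field_simp
  · have := hd.Gamma_ne_zero
    have := he.Gamma_ne_zero
    congr 1
    rw [Complex.Gamma_one]
    simp only [inv_one, mul_one, div_eq_mul_inv, mul_inv, inv_inv]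
    ring

theorem hyp3F2Term_isBigO {d e : ℂ} (a b c : ℂ) (hd : NotNonposInt d) (he : NotNonposInt e) :
    (fun n : ℕ => hyp3F2Term a b c d e (n + 1)) =O[atTop]
      fun n : ℕ => (n : ℝ) ^ (-(d + e + 1 - a - b - c).re) := by
  have h := (tendsto_hyp3F2Term_mul_cpow a b c hd he).isBigO_one ℝ
  set s := d + e + 1 - a - b - c
  have h2 : (fun n : ℕ => (n : ℂ) ^ (-s)) =O[atTop] fun n : ℕ => (n : ℝ) ^ (-s.re) := by
    refine Asymptotics.IsBigO.of_bound 1 ?_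
    filter_upwards [eventually_ge_atTop 1] with n hn
    rw [Complex.norm_natCast_cpow_of_pos (by omega), Complex.neg_re, one_mul]
    exact le_abs_self _
  refine (h.mul h2).congr' ?_ (by simp)
  filter_upwards [eventually_ge_atTop 1] with n hn
  have hn0 : (n : ℂ) ≠ 0 := by exact_mod_cast (by omega : n ≠ 0)
  rw [mul_assoc, ← Complex.cpow_add _ _ hn0]
  simp

theorem summable_hyp3F2Term {a b c d e : ℂ} (hd : NotNonposInt d) (he : NotNonposInt e)
    (hs : 0 < (d + e - a - b - c).re) : Summable (hyp3F2Term a b c d e) := by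
  rw [← summable_nat_add_iff 1]
  refine summable_of_isBigO_nat (Real.summable_nat_rpow.mpr ?_) (hyp3F2Term_isBigO a b c hd he)
  simp only [Complex.sub_re, Complex.add_re, Complex.one_re] at hs ⊢
  linarith

/-- Excess above `-1` is enough for the terms to vanish, though not for summability; this disposes
of the boundary terms in the telescoping arguments. -/
theorem tendsto_hyp3F2Term_zero {a b c d e : ℂ} (hd : NotNonposInt d) (he : NotNonposInt e)
    (hs : 0 < (d + e + 1 - a - b - c).re) : Tendsto (hyp3F2Term a b c d e) atTop (𝓝 0) := by
  rw [← tendsto_add_atTop_iff_nat 1]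
  exact (hyp3F2Term_isBigO a b c hd he).trans_tendsto
    ((tendsto_rpow_neg_atTop hs).comp tendsto_natCast_atTop_atTop)

/-- Excess exactly `-1` is the borderline case: the power of `n` is trivial and the terms tend to a
gamma quotient. This is the source of the gamma quotients in Slater's and Gauss's theorems. -/
theorem tendsto_hyp3F2Term {a b c d e : ℂ} (hd : NotNonposInt d) (he : NotNonposInt e)
    (hs : d + e + 1 - a - b - c = 0) :
    Tendsto (hyp3F2Term a b c d e) atTop (𝓝 (Complex.Gamma d * Complex.Gamma e /
        (Complex.Gamma a * Complex.Gamma b * Complex.Gamma c))) := by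
  rw [← tendsto_add_atTop_iff_nat 1]
  simpa [hs] using tendsto_hyp3F2Term_mul_cpow a b c hd he

/-! ### Telescoping: the first and third identities. -/

theorem Summable.hasSum_of_partial_sums {f g : ℕ → ℂ} {s : ℂ} (hf : Summable f)
    (hg : ∀ n, ∑ k ∈ Finset.range (n + 1), f k = g n) (hs : Tendsto g atTop (𝓝 s)) :
    HasSum f s := by
  rw [hf.hasSum_iff_tendsto_nat, ← tendsto_add_atTop_iff_nat 1]
  exact hs.congr fun n => (hg n).symm

theorem hyp3F2Term_zero (a b c d e : ℂ) : hyp3F2Term a b c d e 0 = 1 := by simp [hyp3F2Term]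

/-- Slater's summation theorem for a series with excess `2`. -/
theorem hasSum_hyp3F2Term_of_slater {a b c d e : ℂ}
    (h₂ : a * b + b * c + c * a = (d - 1) * (e - 1)) (h₁ : d + e - a - b - c = 2)
    (hd : NotNonposInt d) (he : NotNonposInt e) :
    HasSum (hyp3F2Term a b c d e) (gammaQuotient [d, e] [a + 1, b + 1, c + 1]) := by
  -- The `n`-th partial sum equals the `n`-th term of the series with all upper parameters raised by
  -- 1, whose excess is `2 - 3 = -1`.
  have hlim := tendsto_hyp3F2Term (a := a + 1) (b := b + 1) (c := c + 1) hd he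
    (by linear_combination h₁)
  have hs : Summable (hyp3F2Term a b c d e) := summable_hyp3F2Term hd he (by simp [h₁])
  have hval : gammaQuotient [d, e] [a + 1, b + 1, c + 1] = Complex.Gamma d * Complex.Gamma e /
      (Complex.Gamma (a + 1) * Complex.Gamma (b + 1) * Complex.Gamma (c + 1)) := by
    simp [gammaQuotient, mul_assoc]
  rw [hval]
  refine hs.hasSum_of_partial_sums (fun n => ?_) hlim
  induction n with
  | zero => simp [hyp3F2Term_zero]
  | succ n ih =>
    rw [Finset.sum_range_succ, ih]
    have hd' := hd.ascPochhammer_ne_zero n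
    have he' := he.ascPochhammer_ne_zero n
    have hdn := hd.add_natCast_ne_zero n
    have hen := he.add_natCast_ne_zero n
    have hf : (n.factorial : ℂ) ≠ 0 := by exact_mod_cast n.factorial_ne_zero
    have hn1 : (n : ℂ) + 1 ≠ 0 := by exact_mod_cast n.succ_ne_zero
    simp only [hyp3F2Term]
    rw [ascPochhammer_eval_succ_left n a, ascPochhammer_eval_succ_left n b,
      ascPochhammer_eval_succ_left n c, ascPochhammer_succ_eval n d, ascPochhammer_succ_eval n e,
      ascPochhammer_succ_eval n (a + 1), ascPochhammer_succ_eval n (b + 1),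
      ascPochhammer_succ_eval n (c + 1), Nat.factorial_succ]
    push_cast
    field_simp
    linear_combination (ascPochhammer ℂ n).eval (a + 1) * (ascPochhammer ℂ n).eval (b + 1) *
      (ascPochhammer ℂ n).eval (c + 1) * ((n + 1 : ℂ) ^ 2 * h₁ - (n + 1 : ℂ) * h₂)

/-- The third summation theorem, with upper parameter `2`. -/
theorem hasSum_hyp3F2Term_two {a b d e : ℂ} (h : (a - 1) * (b - 1) = (d - 2) * (e - 2))
    (hs : 0 < (d + e - a - b - 2).re) (hd : NotNonposInt d) (he : NotNonposInt e) :
    HasSum (hyp3F2Term a b 2 d e) ((d - 1) * (e - 1) / (d + e - a - b - 2)) := by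
  have hne : d + e - a - b - 2 ≠ 0 := by
    intro h0
    simp [h0] at hs
  -- The function of `n` here is the closed form of the partial sum through index `n`; its variable
  -- part is a term of a series with excess one lower than the original, hence still of real part
  -- above `-1`.
  have hlim : Tendsto (fun n => ((d - 1) * (e - 1) - a * b * hyp3F2Term (a + 1) (b + 1) 1 d e n) /
      (d + e - a - b - 2)) atTop (𝓝 ((d - 1) * (e - 1) / (d + e - a - b - 2))) := by
    have := ((tendsto_hyp3F2Term_zero (a := a + 1) (b := b + 1) (c := 1) hd he (by
      convert hs using 2; ring)).const_mul (a * b)).const_sub ((d - 1) * (e - 1))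
    simpa using this.div_const (d + e - a - b - 2)
  refine (summable_hyp3F2Term hd he (by convert hs using 2)).hasSum_of_partial_sums
    (fun n => ?_) hlim
  induction n with
  | zero =>
    simp only [zero_add, Finset.sum_range_one, hyp3F2Term_zero]
    field_simp
    linear_combination h
  | succ n ih =>
    rw [Finset.sum_range_succ, ih]
    have hd' := hd.ascPochhammer_ne_zero n
    have he' := he.ascPochhammer_ne_zero n
    have hdn := hd.add_natCast_ne_zero n
    have hen := he.add_natCast_ne_zero n
    have hf : (n.factorial : ℂ) ≠ 0 := by exact_mod_cast n.factorial_ne_zero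
    have hn1 : (n : ℂ) + 1 ≠ 0 := by exact_mod_cast n.succ_ne_zero
    have h2 : (ascPochhammer ℂ (n + 1)).eval 2 = (n.factorial : ℂ) * (n + 1) * (n + 2) := by
      have h1 := ascPochhammer_eval_succ_left (n + 1) 1
      rw [ascPochhammer_eval_one, one_add_one_eq_two, one_mul] at h1
      rw [← h1]
      push_cast [Nat.factorial_succ]
      ring
    simp only [hyp3F2Term]
    rw [h2, ascPochhammer_eval_one, ascPochhammer_eval_one, ascPochhammer_eval_succ_left n a,
      ascPochhammer_eval_succ_left n b, ascPochhammer_succ_eval n d, ascPochhammer_succ_eval n e,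
      ascPochhammer_succ_eval n (a + 1), ascPochhammer_succ_eval n (b + 1), Nat.factorial_succ]
    push_cast
    field_simp
    linear_combination (a * b) * (ascPochhammer ℂ n).eval (a + 1) *
      (ascPochhammer ℂ n).eval (b + 1) * h

/-! ### Gauss's theorem and the second identity. -/

/-- The relation between contiguous Gauss series `₂F₁(a, b; e; 1) = ₃F₂(a, b, 1; e, 1; 1)`. -/
theorem tsum_hyp3F2Term_contiguous {a b e : ℂ} (he : NotNonposInt e)
    (hs : 0 < (e - a - b).re) :
    e * (e - a - b) * ∑' k, hyp3F2Term a b 1 e 1 k =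
      (e - a) * (e - b) * ∑' k, hyp3F2Term a b 1 (e + 1) 1 k := by
  have h1 : NotNonposInt 1 := .of_re_pos (by simp)
  have he1 : NotNonposInt (e + 1) := by simpa using he.add_natCast 1
  have hs0 : Summable (hyp3F2Term a b 1 e 1) :=
    summable_hyp3F2Term he h1 (by convert hs using 2; ring)
  have hs1 : Summable (hyp3F2Term a b 1 (e + 1) 1) := by
    refine summable_hyp3F2Term he1 h1 ?_
    simp only [Complex.sub_re, Complex.add_re, Complex.one_re] at hs ⊢
    linarith
  -- The difference of the two sides, summed through index `n`, collapses to this boundary term.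
  have hlim : Tendsto (fun n => -(a * b * hyp3F2Term (a + 1) (b + 1) 1 (e + 1) 1 n)) atTop
      (𝓝 0) := by
    have := (tendsto_hyp3F2Term_zero (a := a + 1) (b := b + 1) (c := 1) he1 h1 (by
      convert hs using 2; ring)).const_mul (a * b)
    simpa using this.neg
  have key := ((hs0.mul_left (e * (e - a - b))).sub
    (hs1.mul_left ((e - a) * (e - b)))).hasSum_of_partial_sums (fun n => ?_) hlim
  · rw [← sub_eq_zero, ← tsum_mul_left, ← tsum_mul_left,
      ← (hs0.mul_left _).tsum_sub (hs1.mul_left _), key.tsum_eq]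
  induction n with
  | zero =>
    simp only [zero_add, Finset.sum_range_one, hyp3F2Term_zero]
    ring
  | succ n ih =>
    rw [Finset.sum_range_succ, ih]
    have he' := he1.ascPochhammer_ne_zero n
    have he0 := he.add_natCast_ne_zero 0
    rw [Nat.cast_zero, add_zero] at he0
    have hen := he1.add_natCast_ne_zero n
    have hf : (n.factorial : ℂ) ≠ 0 := by exact_mod_cast n.factorial_ne_zero
    have hn1 : (n : ℂ) + 1 ≠ 0 := by exact_mod_cast n.succ_ne_zero
    simp only [hyp3F2Term]
    rw [ascPochhammer_eval_one, ascPochhammer_eval_one, ascPochhammer_eval_succ_left n a,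
      ascPochhammer_eval_succ_left n b, ascPochhammer_eval_succ_left n e,
      ascPochhammer_succ_eval n (e + 1),
      ascPochhammer_succ_eval n (a + 1), ascPochhammer_succ_eval n (b + 1), Nat.factorial_succ]
    push_cast
    field_simp
    ring

/-- In the right half-plane a shift to the right increases the modulus of every factor. This yields
one dominating series for all large shifts of the lower parameter. -/
theorem norm_ascPochhammer_le {z w : ℂ} (hz : 0 ≤ z.re) (hw : ∃ r : ℝ, 0 ≤ r ∧ w = z + r)
    (n : ℕ) : ‖(ascPochhammer ℂ n).eval z‖ ≤ ‖(ascPochhammer ℂ n).eval w‖ := by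
  obtain ⟨r, hr, rfl⟩ := hw
  rw [ascPochhammer_eval_eq_prod_range, ascPochhammer_eval_eq_prod_range, norm_prod, norm_prod]
  refine Finset.prod_le_prod (fun _ _ => norm_nonneg _) fun j _ => ?_
  rw [Complex.norm_def, Complex.norm_def]
  refine Real.sqrt_le_sqrt ?_
  simp only [Complex.normSq_apply, Complex.add_re, Complex.add_im, Complex.natCast_re,
    Complex.natCast_im, Complex.ofReal_re, Complex.ofReal_im, add_zero]
  have : (0 : ℝ) ≤ j := j.cast_nonneg
  gcongr <;> linarith

/-- Dominated convergence: as the lower parameter moves to infinity every term except the zeroth,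
which is 1, tends to 0. -/
theorem tendsto_tsum_hyp3F2Term_add_nat {a b e : ℂ} (he : NotNonposInt e)
    (hs : 0 < (e - a - b).re) :
    Tendsto (fun n : ℕ => ∑' k, hyp3F2Term a b 1 (e + n) 1 k) atTop (𝓝 1) := by
  have h1 : NotNonposInt 1 := .of_re_pos (by simp)
  -- From `N` on, `e + n` lies in the closed right half-plane, where the moduli of rising factorials
  -- are monotone.
  obtain ⟨N, hN⟩ := exists_nat_ge (-e.re)
  have hsum : Summable (hyp3F2Term a b 1 (e + N) 1) := by
    refine summable_hyp3F2Term (he.add_natCast N) h1 ?_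
    simp only [Complex.sub_re, Complex.add_re, Complex.one_re, Complex.natCast_re] at hs ⊢
    linarith [(N.cast_nonneg : (0 : ℝ) ≤ N)]
  have hlim : ∀ k : ℕ, Tendsto (fun n : ℕ => hyp3F2Term a b 1 (e + n) 1 k) atTop
      (𝓝 (if k = 0 then 1 else 0)) := by
    intro k
    cases k with
    | zero => simp [hyp3F2Term_zero]
    | succ k =>
      have hdeg : 0 < (ascPochhammer ℂ (k + 1)).degree := by
        rw [Polynomial.degree_eq_natDegree (monic_ascPochhammer ℂ (k + 1)).ne_zero,
          ascPochhammer_natDegree]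
        exact_mod_cast k.succ_pos
      have hnorm : Tendsto (fun n : ℕ => ‖e + n‖) atTop atTop := by
        refine tendsto_atTop_mono (f := fun n : ℕ => e.re + n) (fun n => ?_)
          (tendsto_atTop_add_const_left _ _ tendsto_natCast_atTop_atTop)
        simpa using Complex.re_le_norm (e + n)
      have hinv := tendsto_inv₀_cobounded.comp
        (tendsto_norm_atTop_iff_cobounded.mp (Polynomial.tendsto_norm_atTop _ hdeg hnorm))
      have := hinv.const_mul ((ascPochhammer ℂ (k + 1)).eval a * (ascPochhammer ℂ (k + 1)).eval b /
        ((k + 1).factorial : ℂ))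
      rw [mul_zero] at this
      rw [if_neg k.succ_ne_zero]
      refine this.congr fun n => ?_
      have hf : ((k + 1).factorial : ℂ) ≠ 0 := by exact_mod_cast (k + 1).factorial_ne_zero
      have hk := (he.add_natCast n).ascPochhammer_ne_zero (k + 1)
      simp only [hyp3F2Term, Function.comp_apply]
      rw [ascPochhammer_eval_one]
      field_simp
  have := tendsto_tsum_of_dominated_convergence (f := fun (n : ℕ) k => hyp3F2Term a b 1 (e + n) 1 k)
    (𝓕 := atTop) (bound := fun k => ‖hyp3F2Term a b 1 (e + N) 1 k‖) hsum.norm hlim ?_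
  · simpa using this
  · filter_upwards [eventually_ge_atTop N] with n hn k
    have hle := norm_ascPochhammer_le (z := e + N) (w := e + n) (by simp; linarith)
      ⟨(n : ℝ) - N, by simpa using hn, by push_cast; ring⟩ k
    have hpos := norm_pos_iff.mpr ((he.add_natCast N).ascPochhammer_ne_zero k)
    have hpos1 := norm_pos_iff.mpr (h1.ascPochhammer_ne_zero k)
    have hfac : 0 < ‖(k.factorial : ℂ)‖ :=
      norm_pos_iff.mpr (by exact_mod_cast k.factorial_ne_zero)
    simp only [hyp3F2Term, norm_div, norm_mul]
    gcongr

/-- Gauss's summation theorem. -/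
theorem hasSum_gauss {a b e : ℂ} (he : NotNonposInt e) (hs : 0 < (e - a - b).re) :
    HasSum (hyp3F2Term a b 1 e 1) (gammaQuotient [e, e - a - b] [e - a, e - b]) := by
  have h1 : NotNonposInt 1 := .of_re_pos (by simp)
  have hs' : NotNonposInt (e - a - b) := .of_re_pos hs
  have hsum : Summable (hyp3F2Term a b 1 e 1) :=
    summable_hyp3F2Term he h1 (by convert hs using 2; ring)
  -- Iterating the contiguous relation `n` times produces a quotient of rising factorials that is
  -- itself a term of a series of excess `-1`, so its limit is the desired gamma quotient.
  have hiter : ∀ n : ℕ, ∑' k, hyp3F2Term a b 1 e 1 k =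
      hyp3F2Term (e - a) (e - b) 1 e (e - a - b) n * ∑' k, hyp3F2Term a b 1 (e + n) 1 k := by
    intro n
    induction n with
    | zero => simp [hyp3F2Term_zero]
    | succ n ih =>
      have hc := tsum_hyp3F2Term_contiguous (a := a) (b := b) (he.add_natCast n) (by
        simp only [Complex.sub_re, Complex.add_re, Complex.natCast_re] at hs ⊢
        linarith [(n.cast_nonneg : (0 : ℝ) ≤ n)])
      have hen := he.add_natCast_ne_zero n
      have hsn := hs'.add_natCast_ne_zero n
      have hsn' : e + n - a - b ≠ 0 := by convert hsn using 1; ring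
      rw [ih, Nat.cast_succ, ← add_assoc]
      rw [mul_comm, ← eq_div_iff (mul_ne_zero hen hsn')] at hc
      rw [hc]
      have hf : (n.factorial : ℂ) ≠ 0 := by exact_mod_cast n.factorial_ne_zero
      have hn1 : (n : ℂ) + 1 ≠ 0 := by exact_mod_cast n.succ_ne_zero
      have := he.ascPochhammer_ne_zero n
      have := hs'.ascPochhammer_ne_zero n
      simp only [hyp3F2Term]
      rw [ascPochhammer_eval_one, ascPochhammer_eval_one, ascPochhammer_succ_eval,
        ascPochhammer_succ_eval, ascPochhammer_succ_eval, ascPochhammer_succ_eval,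
        Nat.factorial_succ, show e - a - b + n = e + n - a - b by ring]
      push_cast
      field_simp
      ring
  have hlim := (tendsto_hyp3F2Term (a := e - a) (b := e - b) (c := 1) he hs' (by ring)).mul
    (tendsto_tsum_hyp3F2Term_add_nat he hs)
  have heq := tendsto_nhds_unique (tendsto_const_nhds.congr hiter) hlim
  convert hsum.hasSum using 1
  rw [heq]
  simp [gammaQuotient]

/-- The second summation theorem, with a lower parameter exceeding an upper one by `2`. -/
theorem hasSum_hyp3F2Term_add_two {a b c e : ℂ}
    (h : (a - 1) * (b - 1) = ((a - 1) + (b - 1) - (e - 1)) * c) (hs : 0 < (e - a - b + 2).re)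
    (hc : NotNonposInt (c + 2)) (he : NotNonposInt e) :
    HasSum (hyp3F2Term a b c (c + 2) e)
      (gammaQuotient [e, e - a - b + 2, c + 2] [e - a + 1, e - b + 1, c + 1]) := by
  -- The comparison series is `c + 1` times the Gauss series with `a` and `b` lowered by 1; the
  -- partial sums of the difference are the boundary term in `hlim`.
  have hgauss := (hasSum_gauss (a := a - 1) (b := b - 1) he (by convert hs using 2; ring)).mul_left
    (c + 1)
  have hlim : Tendsto (fun n => -(c * hyp3F2Term a b (c + 1) (c + 2) e n)) atTop (𝓝 0) := by
    have := (tendsto_hyp3F2Term_zero (a := a) (b := b) (c := c + 1) hc he (by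
      convert hs using 2; ring)).const_mul c
    simpa using this.neg
  have hsum : Summable (hyp3F2Term a b c (c + 2) e) :=
    summable_hyp3F2Term hc he (by convert hs using 2; ring)
  have key := (hsum.sub hgauss.summable).hasSum_of_partial_sums (fun n => ?_) hlim
  · convert key.add hgauss using 1
    · simp
    · have hg : Complex.Gamma (c + 2) / Complex.Gamma (c + 1) = c + 1 := by
        -- At `c = -1` the convention `Γ(0) = 0` makes the quotient 0, which is the correct value.
        by_cases hc0 : c + 1 = 0
        · simp [hc0]
        have hc1 : NotNonposInt (c + 1) := by
          rintro (_ | n) hn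
          · exact hc0 (by simpa using hn)
          · exact hc n (by push_cast at hn; linear_combination hn)
        have := Complex.Gamma_add_one _ hc0
        rw [add_assoc, one_add_one_eq_two] at this
        rw [this, mul_div_cancel_right₀ _ hc1.Gamma_ne_zero]
      have hval : gammaQuotient [e, e - a - b + 2, c + 2] [e - a + 1, e - b + 1, c + 1] =
          Complex.Gamma (c + 2) / Complex.Gamma (c + 1) *
            gammaQuotient [e, e - (a - 1) - (b - 1)] [e - (a - 1), e - (b - 1)] := by
        simp only [gammaQuotient, List.map_cons, List.map_nil, List.prod_cons, List.prod_nil,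
          mul_one]
        rw [div_mul_div_comm]
        ring_nf
      rw [zero_add, hval, hg]
  induction n with
  | zero =>
    simp only [zero_add, Finset.sum_range_one, hyp3F2Term_zero]
    ring
  | succ n ih =>
    rw [Finset.sum_range_succ, ih]
    have hc' := hc.ascPochhammer_ne_zero n
    have he' := he.ascPochhammer_ne_zero n
    have hcn := hc.add_natCast_ne_zero n
    have hen := he.add_natCast_ne_zero n
    have hf : (n.factorial : ℂ) ≠ 0 := by exact_mod_cast n.factorial_ne_zero
    have hn1 : (n : ℂ) + 1 ≠ 0 := by exact_mod_cast n.succ_ne_zero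
    -- The rising factorials of `c + 1` and `c + 2` become independent atoms below; this is the only
    -- relation between them that is needed.
    have hQ := ascPochhammer_eval_mul_add n (c + 1)
    rw [add_assoc c 1 1, one_add_one_eq_two] at hQ
    have ha := ascPochhammer_eval_succ_left n (a - 1)
    have hb := ascPochhammer_eval_succ_left n (b - 1)
    rw [sub_add_cancel] at ha hb
    simp only [hyp3F2Term]
    rw [ha, hb, ascPochhammer_eval_one, ascPochhammer_eval_succ_left n c,
      ascPochhammer_succ_eval n (c + 1), ascPochhammer_succ_eval n (c + 2),
      ascPochhammer_succ_eval n e, ascPochhammer_succ_eval n a, ascPochhammer_succ_eval n b,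
      Nat.factorial_succ]
    push_cast
    generalize (ascPochhammer ℂ n).eval (c + 2) = P at *
    generalize (ascPochhammer ℂ n).eval (c + 1) = Q at *
    generalize (ascPochhammer ℂ n).eval a = A at *
    generalize (ascPochhammer ℂ n).eval b = B at *
    generalize (ascPochhammer ℂ n).eval e = E at *
    field_simp
    linear_combination A * B * (c + 2 + n) * ((c * Q - P * (c + 1)) * h + c * (a + b - e - 1) * hQ)

/-! ### Irreducibility and dimension of `varietyIII`. -/

/-- The equation says that the matrix with rows `(a - 1, d - 2)` and `(e - 2, b - 1)` is singular,
so it is a column `(s, q)` times a row `(t, p)`. The variety is thus the full image of an affine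
space. -/
theorem mem_varietyIII_iff_exists {v : Fin 5 → ℂ} :
    v ∈ varietyIII ↔ ∃ s t p q : ℂ, v = ![s * t + 1, p * q + 1, 2, s * p + 2, t * q + 2] := by
  constructor
  · rintro ⟨h, h2⟩
    suffices ∃ s t p q : ℂ, v 0 = s * t + 1 ∧ v 1 = p * q + 1 ∧ v 3 = s * p + 2 ∧
        v 4 = t * q + 2 by
      obtain ⟨s, t, p, q, h0, h1, h3, h4⟩ := this
      refine ⟨s, t, p, q, ?_⟩
      ext i
      fin_cases i
      exacts [h0, h1, h2, h3, h4]
    by_cases h0 : v 0 - 1 = 0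
    · rw [h0, zero_mul, eq_comm, mul_eq_zero] at h
      rcases h with h | h
      · refine ⟨0, v 4 - 2, v 1 - 1, 1, ?_, ?_, ?_, ?_⟩
        · linear_combination h0
        · ring
        · linear_combination h
        · ring
      · refine ⟨v 3 - 2, 0, 1, v 1 - 1, ?_, ?_, ?_, ?_⟩
        · linear_combination h0
        · ring
        · ring
        · linear_combination h
    · refine ⟨v 0 - 1, 1, (v 3 - 2) / (v 0 - 1), v 4 - 2, ?_, ?_, ?_, ?_⟩ <;> field_simp
      · ring
      · linear_combination h
      · ring
      · ring
  · rintro ⟨s, t, p, q, rfl⟩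
    refine ⟨?_, rfl⟩
    simp only [Matrix.cons_val]
    ring

/-- The comorphism of the parametrisation `(s, t, p, q) ↦ (st + 1, pq + 1, 2; sp + 2, tq + 2)`
of `varietyIII`. -/
def varietyIIIParam : MvPolynomial (Fin 5) ℂ →ₐ[ℂ] MvPolynomial (Fin 4) ℂ :=
  aeval ![X 0 * X 1 + 1, X 2 * X 3 + 1, 2, X 0 * X 2 + 2, X 1 * X 3 + 2]

theorem aeval_aeval_apply {σ τ : Type*} (f : σ → MvPolynomial τ ℂ) (w : τ → ℂ)
    (p : MvPolynomial σ ℂ) :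
    aeval w (aeval f p) = aeval (fun i => aeval w (f i)) p := by
  rw [← AlgHom.comp_apply, comp_aeval]

/-- Since the parametrisation is onto, a polynomial vanishes on the variety exactly when its
pullback vanishes as a function, hence as a polynomial. Primality follows because the target is a
domain. -/
theorem vanishingIdeal_varietyIII :
    vanishingIdeal ℂ varietyIII = RingHom.ker varietyIIIParam := by
  ext p
  have hw : ∀ w : Fin 4 → ℂ, aeval w (varietyIIIParam p) =
      aeval ![w 0 * w 1 + 1, w 2 * w 3 + 1, 2, w 0 * w 2 + 2, w 1 * w 3 + 2] p := by
    intro w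
    rw [varietyIIIParam, aeval_aeval_apply]
    congr 2
    ext i
    fin_cases i <;> simp
  rw [mem_vanishingIdeal_iff, RingHom.mem_ker]
  constructor
  · intro h
    refine MvPolynomial.funext fun w => ?_
    rw [map_zero, ← aeval_eq_eval, hw]
    exact h _ (mem_varietyIII_iff_exists.mpr ⟨_, _, _, _, rfl⟩)
  · rintro h v hv
    obtain ⟨s, t, p, q, rfl⟩ := mem_varietyIII_iff_exists.mp hv
    simpa [h] using (hw ![s, t, p, q]).symm

theorem vanishingIdeal_varietyIII_isPrime : (vanishingIdeal ℂ varietyIII).IsPrime := by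
  rw [vanishingIdeal_varietyIII]
  exact RingHom.ker_isPrime _

theorem ringKrullDim_mvPolynomial_fin (n : ℕ) : ringKrullDim (MvPolynomial (Fin n) ℂ) = n := by
  simp

/-- As `c` is constant, the coordinate ring is a quotient of a polynomial ring in four variables in
which the nonzero quadric dies, so at least one dimension is lost. -/
theorem ringKrullDim_varietyIII_le :
    ringKrullDim (MvPolynomial (Fin 5) ℂ ⧸ vanishingIdeal ℂ varietyIII) ≤ 3 := by
  set I := vanishingIdeal ℂ varietyIII
  let f : MvPolynomial (Fin 4) ℂ →ₐ[ℂ] MvPolynomial (Fin 5) ℂ :=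
    aeval ![X 0 - 1, X 1 - 1, X 3 - 2, X 4 - 2]
  let g : MvPolynomial (Fin 5) ℂ →ₐ[ℂ] MvPolynomial (Fin 4) ℂ :=
    aeval ![X 0 + 1, X 1 + 1, 2, X 2 + 2, X 3 + 2]
  have hfg : ((Ideal.Quotient.mkₐ ℂ I).comp f).comp g = Ideal.Quotient.mkₐ ℂ I := by
    refine MvPolynomial.algHom_ext fun i => ?_
    simp only [AlgHom.comp_apply, Ideal.Quotient.mkₐ_eq_mk, Ideal.Quotient.mk_eq_mk_iff_sub_mem]
    rw [mem_vanishingIdeal_iff]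
    intro v hv
    fin_cases i <;> simp [f, g, hv.2, map_ofNat (bind₁ _) 2]
  have hsurj : Function.Surjective ((Ideal.Quotient.mkₐ ℂ I).comp f) := by
    intro x
    obtain ⟨p, rfl⟩ := Ideal.Quotient.mk_surjective x
    exact ⟨g p, DFunLike.congr_fun hfg p⟩
  have hq : (X 0 * X 1 - X 2 * X 3 : MvPolynomial (Fin 4) ℂ) ≠ 0 := by
    intro h
    simpa using congrArg (eval ![1, 1, 0, 0]) h
  have hq0 : (Ideal.Quotient.mkₐ ℂ I).comp f (X 0 * X 1 - X 2 * X 3) = 0 := by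
    rw [AlgHom.comp_apply, Ideal.Quotient.mkₐ_eq_mk, Ideal.Quotient.eq_zero_iff_mem,
      mem_vanishingIdeal_iff]
    intro v hv
    simp [f, hv.1]
  have := ringKrullDim_succ_le_of_surjective ((Ideal.Quotient.mkₐ ℂ I).comp f).toRingHom hsurj
    (mem_nonZeroDivisors_of_ne_zero hq) hq0
  rw [ringKrullDim_mvPolynomial_fin] at this
  exact (ENat.WithBot.add_le_add_one_right_iff (b := 3)).mp (this.trans_eq (by norm_num))

/-- Restriction to the plane `a = 1`, `c = d = 2` inside the variety maps the coordinate ring onto a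
polynomial ring in two variables and kills `a - 1`, a nonzero element of a domain. The dimension
therefore exceeds 2. -/
theorem le_ringKrullDim_varietyIII :
    3 ≤ ringKrullDim (MvPolynomial (Fin 5) ℂ ⧸ vanishingIdeal ℂ varietyIII) := by
  have hprime := vanishingIdeal_varietyIII_isPrime
  set I := vanishingIdeal ℂ varietyIII
  let f : MvPolynomial (Fin 5) ℂ →ₐ[ℂ] MvPolynomial (Fin 2) ℂ :=
    aeval ![1, X 0 + 1, 2, 2, X 1 + 2]
  have hf : ∀ p ∈ I, f p = 0 := by
    intro p hp
    refine MvPolynomial.funext fun w => ?_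
    rw [map_zero, ← aeval_eq_eval, aeval_aeval_apply]
    refine hp _ ⟨?_, ?_⟩ <;> simp
  have hsurj : Function.Surjective (Ideal.Quotient.liftₐ I f hf) := by
    intro p
    refine ⟨Ideal.Quotient.mkₐ ℂ I (aeval ![X 1 - 1, X 4 - 2] p), ?_⟩
    have : (f.comp (aeval ![X 1 - 1, X 4 - 2])) = AlgHom.id ℂ _ := by
      refine MvPolynomial.algHom_ext fun i => ?_
      fin_cases i <;> simp [f, map_ofNat (bind₁ _) 2]
    exact DFunLike.congr_fun this p
  have hne : Ideal.Quotient.mk I (X 0 - 1) ≠ 0 := by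
    rw [Ne, Ideal.Quotient.eq_zero_iff_mem]
    intro h
    have := h ![2, 1, 2, 2, 2] (by simp [varietyIII])
    norm_num at this
  have h0 : Ideal.Quotient.liftₐ I f hf (Ideal.Quotient.mk I (X 0 - 1)) = 0 := by
    change f (X 0 - 1) = 0
    simp [f]
  have := ringKrullDim_succ_le_of_surjective (Ideal.Quotient.liftₐ I f hf).toRingHom hsurj
    (mem_nonZeroDivisors_of_ne_zero hne) h0
  rw [ringKrullDim_mvPolynomial_fin] at this
  exact this

theorem varietyIII_isVarietyOfDim : IsVarietyOfDim varietyIII 3 := by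
  refine ⟨⟨{(X 0 - 1) * (X 1 - 1) - (X 3 - 2) * (X 4 - 2), X 2 - 2}, ?_⟩,
    vanishingIdeal_varietyIII_isPrime,
    le_antisymm ringKrullDim_varietyIII_le le_ringKrullDim_varietyIII⟩
  ext v
  simp [varietyIII, sub_eq_zero]

/-! ### Invariance under linear automorphisms; non-planarity. -/

/-- The endomorphism `p ↦ p ∘ e` of the polynomial ring given by a linear map `e`. -/
def linearSubst (e : (Fin 5 → ℂ) →ₗ[ℂ] (Fin 5 → ℂ)) :
    MvPolynomial (Fin 5) ℂ →ₐ[ℂ] MvPolynomial (Fin 5) ℂ :=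
  aeval fun i => ∑ j, C (e (Pi.single j 1) i) * X j

theorem aeval_linearSubst (e : (Fin 5 → ℂ) →ₗ[ℂ] (Fin 5 → ℂ)) (v : Fin 5 → ℂ)
    (p : MvPolynomial (Fin 5) ℂ) : aeval v (linearSubst e p) = aeval (e v) p := by
  rw [linearSubst, aeval_aeval_apply]
  congr 2
  ext i
  conv_rhs => rw [LinearMap.pi_apply_eq_sum_univ e v]
  simp only [map_sum, map_mul, aeval_C, aeval_X, Algebra.algebraMap_self, RingHom.id_apply,
    smul_eq_mul, Finset.sum_apply, Pi.smul_apply]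
  refine Finset.sum_congr rfl fun j _ => ?_
  have : (Pi.single j 1 : Fin 5 → ℂ) = fun k => if j = k then 1 else 0 := by
    ext k
    simp [Pi.single_apply, eq_comm]
  rw [mul_comm, this]

theorem linearSubst_linearSubst {e e' : (Fin 5 → ℂ) →ₗ[ℂ] (Fin 5 → ℂ)}
    (h : ∀ v, e (e' v) = v) (p : MvPolynomial (Fin 5) ℂ) :
    linearSubst e' (linearSubst e p) = p := by
  refine MvPolynomial.funext fun v => ?_
  rw [← aeval_eq_eval, aeval_linearSubst, aeval_linearSubst, h]

def linearSubstEquiv (e : (Fin 5 → ℂ) ≃ₗ[ℂ] (Fin 5 → ℂ)) :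
    MvPolynomial (Fin 5) ℂ ≃ₐ[ℂ] MvPolynomial (Fin 5) ℂ :=
  AlgEquiv.ofAlgHom (linearSubst e) (linearSubst e.symm)
    (AlgHom.ext fun p => linearSubst_linearSubst (fun v => e.symm_apply_apply v) p)
    (AlgHom.ext fun p => linearSubst_linearSubst (fun v => e.apply_symm_apply v) p)

theorem comap_vanishingIdeal (e : (Fin 5 → ℂ) ≃ₗ[ℂ] (Fin 5 → ℂ)) (V : Set (Fin 5 → ℂ)) :
    vanishingIdeal ℂ (e • V) = (vanishingIdeal ℂ V).comap (linearSubstEquiv e) := by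
  ext p
  simp only [Ideal.mem_comap, mem_vanishingIdeal_iff, Set.mem_smul_set, forall_exists_index,
    and_imp, forall_apply_eq_imp_iff₂]
  refine forall₂_congr fun v hv => ?_
  exact (aeval_linearSubst e v p).symm ▸ Iff.rfl

theorem IsVarietyOfDim.smul {V : Set (Fin 5 → ℂ)} {n : ℕ} (hV : IsVarietyOfDim V n)
    (e : (Fin 5 → ℂ) ≃ₗ[ℂ] (Fin 5 → ℂ)) : IsVarietyOfDim (e • V) n := by
  obtain ⟨⟨S, hS⟩, hprime, hdim⟩ := hV
  refine ⟨⟨linearSubst e.symm '' S, ?_⟩, ?_, ?_⟩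
  · ext v
    rw [Set.mem_smul_set_iff_inv_smul_mem, hS]
    simp only [Set.mem_ofPred_eq, Set.forall_mem_image]
    refine forall₂_congr fun p _ => ?_
    have := aeval_linearSubst e.symm v p
    simp only [aeval_eq_eval] at this
    exact this.symm ▸ Iff.rfl
  · rw [comap_vanishingIdeal]
    exact Ideal.comap_isPrime _ _
  · rw [← hdim]
    refine (ringKrullDim_eq_of_ringEquiv (Ideal.quotientEquiv _ _
      (linearSubstEquiv e).toRingEquiv ?_))
    rw [comap_vanishingIdeal]
    exact (Ideal.map_comap_of_surjective _ (linearSubstEquiv e).surjective _).symm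

theorem IsPlaneOfDim.midpoint_mem {V : Set (Fin 5 → ℂ)} {n : ℕ} (hV : IsPlaneOfDim V n)
    {v w : Fin 5 → ℂ} (hv : v ∈ V) (hw : w ∈ V) : (1 / 2 : ℂ) • (v + w) ∈ V := by
  obtain ⟨P, _, _, rfl⟩ := hV
  have := AffineMap.lineMap_mem (1 / 2 : ℂ) hv hw
  rw [SetLike.mem_coe]
  convert this using 1
  rw [AffineMap.lineMap_apply_module]
  module

/-- An affine subspace is closed under midpoints, but the midpoint of these two points has `(a -
1)(b - 1) = 1/4` and `(d - 2)(e - 2) = 0`. -/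
theorem not_isPlaneOfDim_smul_varietyIII (e : (Fin 5 → ℂ) ≃ₗ[ℂ] (Fin 5 → ℂ)) (n : ℕ) :
    ¬ IsPlaneOfDim (e • varietyIII) n := by
  intro h
  have h1 : (![2, 1, 2, 2, 2] : Fin 5 → ℂ) ∈ varietyIII := by simp [varietyIII]
  have h2 : (![1, 2, 2, 2, 2] : Fin 5 → ℂ) ∈ varietyIII := by simp [varietyIII]
  have := h.midpoint_mem (Set.smul_mem_smul_set (a := e) h1) (Set.smul_mem_smul_set (a := e) h2)
  rw [← smul_add, smul_comm, Set.smul_mem_smul_set_iff] at this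
  have := this.1
  simp only [Pi.smul_apply, Pi.add_apply, Matrix.cons_val, smul_eq_mul] at this
  norm_num at this

/-! ### The Thomae group and the orbit of the Slater variety. -/

theorem permRep_apply (σ : Equiv.Perm (Fin 5)) (v : Fin 5 → ℂ) (i : Fin 5) :
    permRep σ v i = v (σ⁻¹ i) := rfl

theorem thomaeRep_thomaeCoord (σ : Equiv.Perm (Fin 5)) (x : Fin 5 → ℂ) :
    thomaeRep σ (thomaeCoord x) = thomaeCoord (permRep σ x) := by
  change thomaeCoord (permRep σ (thomaeCoord.symm (thomaeCoord x))) = _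
  rw [LinearEquiv.symm_apply_apply]

/-- In this form the coordinate change depends on the labelling only through the subset `{0, 1, 2}`,
so it commutes with every permutation preserving that subset. -/
theorem thomaeCoord_apply (x : Fin 5 → ℂ) (i : Fin 5) :
    thomaeCoord x i = x i +
      (∑ j, x j - if i ∈ ({0, 1, 2} : Finset (Fin 5)) then ∑ j ∈ {0, 1, 2}, x j else 0) := by
  change Matrix.vecMul x thomaeMatrix i = _
  fin_cases i <;>
    simp [thomaeMatrix, Matrix.vecMul, dotProduct, Fin.sum_univ_five] <;> ring

theorem sum_permRep_map (σ : Equiv.Perm (Fin 5)) (S : Finset (Fin 5)) (f : ℂ → ℂ)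
    (x : Fin 5 → ℂ) : ∑ j ∈ S.map σ.toEmbedding, f (permRep σ x j) = ∑ j ∈ S, f (x j) := by
  simp [permRep_apply]

theorem sum_permRep (σ : Equiv.Perm (Fin 5)) (f : ℂ → ℂ) (x : Fin 5 → ℂ) :
    ∑ j, f (permRep σ x j) = ∑ j, f (x j) := by
  simpa using sum_permRep_map σ Finset.univ f x

theorem mem_map_iff_of_map_eq {σ : Equiv.Perm (Fin 5)} {S : Finset (Fin 5)}
    (h : S.map σ.toEmbedding = S) (i : Fin 5) : σ⁻¹ i ∈ S ↔ i ∈ S := by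
  conv_rhs => rw [← h, Finset.mem_map_equiv]
  rfl

theorem thomaeRep_eq_permRep {σ : Equiv.Perm (Fin 5)}
    (h : ({0, 1, 2} : Finset (Fin 5)).map σ.toEmbedding = {0, 1, 2}) :
    thomaeRep σ = permRep σ := by
  ext v i
  obtain ⟨x, rfl⟩ := thomaeCoord.surjective v
  have h1 := sum_permRep σ id x
  have h2 := sum_permRep_map σ {0, 1, 2} id x
  rw [h] at h2
  simp only [id] at h1 h2
  rw [thomaeRep_thomaeCoord, thomaeCoord_apply, h1, h2, permRep_apply, permRep_apply,
    thomaeCoord_apply]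
  simp only [mem_map_iff_of_map_eq h]

theorem mem_stabilizer_iff {σ : Equiv.Perm (Fin 5)} :
    σ ∈ MulAction.stabilizer (Equiv.Perm (Fin 5)) ({0, 1, 2} : Set (Fin 5)) ↔
      ({0, 1, 2} : Finset (Fin 5)).map σ.toEmbedding = {0, 1, 2} := by
  rw [MulAction.mem_stabilizer_iff, ← Finset.coe_inj, Finset.coe_map]
  push_cast
  rfl

theorem slaterVariety_eq_varietyI : slaterVariety = varietyI := by
  have hcard3 : ∀ f : Fin 3 → ℂ, ∑ s ∈ Finset.powersetCard 2 Finset.univ, ∏ i ∈ s, f i =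
      f 0 * f 1 + f 1 * f 2 + f 2 * f 0 := by
    intro f
    rw [show Finset.powersetCard 2 (Finset.univ : Finset (Fin 3)) = {{0, 1}, {1, 2}, {2, 0}} by
      decide, Finset.sum_insert (by decide), Finset.sum_insert (by decide), Finset.sum_singleton,
      Finset.prod_pair (by decide), Finset.prod_pair (by decide), Finset.prod_pair (by decide)]
    ring
  have hcard2 : ∀ f : Fin 2 → ℂ, ∑ s ∈ Finset.powersetCard 2 Finset.univ, ∏ i ∈ s, f i =
      f 0 * f 1 := by
    intro f
    rw [show Finset.powersetCard 2 (Finset.univ : Finset (Fin 2)) = {{0, 1}} by decide,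
      Finset.sum_singleton, Finset.prod_pair (by decide)]
  have hone : ∀ {n : ℕ} (f : Fin n → ℂ), ∑ s ∈ Finset.powersetCard 1 Finset.univ, ∏ i ∈ s, f i =
      ∑ i, f i := by
    intro n f
    simp [Finset.powersetCard_one]
  ext v
  constructor
  · intro h
    have h1 := h 1 le_rfl one_le_two
    have h2 := h 2 one_le_two le_rfl
    rw [hone, hone, Fin.sum_univ_three, Fin.sum_univ_two] at h1
    rw [hcard3, hcard2] at h2
    simp only [Matrix.cons_val] at h1 h2
    exact ⟨h2, by linear_combination -h1⟩
  · rintro ⟨h2, h1⟩ k hk1 hk2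
    obtain rfl | rfl : k = 1 ∨ k = 2 := by omega
    · rw [hone, hone, Fin.sum_univ_three, Fin.sum_univ_two]
      simp only [Matrix.cons_val]
      linear_combination -h1
    · rw [hcard3, hcard2]
      simpa using h2

/-- The image of the Slater variety under a permutation of the Thomae coordinates that carries
`{x, y, z}` to `S`. -/
def thomaeVariety (S : Finset (Fin 5)) : Set (Fin 5 → ℂ) :=
  thomaeCoord '' {x | ∑ j ∈ S, x j = 2 ∧
    (∑ j, x j) ^ 2 - 2 * ∑ j, x j + ∑ j, x j ^ 2 + 2 = 2 * ∑ j ∈ S, x j ^ 2}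

/-- The defining equations involve only power sums over all coordinates and over `S`, and a
permutation carries the latter to power sums over the image of `S`. -/
theorem thomaeRep_smul_thomaeVariety (σ : Equiv.Perm (Fin 5)) (S : Finset (Fin 5)) :
    thomaeRep σ • thomaeVariety S = thomaeVariety (S.map σ.toEmbedding) := by
  ext v
  simp only [thomaeVariety, Set.mem_smul_set, Set.exists_mem_image]
  constructor
  · rintro ⟨x, hx, rfl⟩
    refine ⟨permRep σ x, ?_, (thomaeRep_thomaeCoord σ x).symm⟩
    have h1 := sum_permRep σ id x
    have h2 := sum_permRep_map σ S id x
    simp only [id] at h1 h2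
    simpa [-Finset.sum_map, h1, h2, sum_permRep σ (· ^ 2) x, sum_permRep_map σ S (· ^ 2) x] using hx
  · rintro ⟨y, hy, rfl⟩
    obtain ⟨x, rfl⟩ := (permRep σ).surjective y
    refine ⟨x, ?_, thomaeRep_thomaeCoord σ x⟩
    have h1 := sum_permRep σ id x
    have h2 := sum_permRep_map σ S id x
    simp only [id] at h1 h2
    simpa [-Finset.sum_map, h1, h2, sum_permRep σ (· ^ 2) x, sum_permRep_map σ S (· ^ 2) x] using hy

theorem eq_thomaeVariety {V : Set (Fin 5 → ℂ)} {S : Finset (Fin 5)}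
    (h : ∀ x, thomaeCoord x ∈ V ↔ ∑ j ∈ S, x j = 2 ∧
      (∑ j, x j) ^ 2 - 2 * ∑ j, x j + ∑ j, x j ^ 2 + 2 = 2 * ∑ j ∈ S, x j ^ 2) :
    V = thomaeVariety S := by
  ext v
  obtain ⟨x, rfl⟩ := thomaeCoord.surjective v
  rw [thomaeVariety, thomaeCoord.injective.mem_set_image, h]
  rfl

/-- The excess is `x + y + z` in Thomae coordinates. Modulo the linear equation, the two quadrics
differ by a factor 2; the same works for `varietyII`, where `d - c = x + y + u`, and with factor
`-2` for `varietyIII`, where `c = z + u + v`. -/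
theorem varietyI_eq : varietyI = thomaeVariety {0, 1, 2} := by
  refine eq_thomaeVariety fun v => ?_
  simp only [varietyI, Set.mem_ofPred_eq, thomaeCoord_apply, Fin.sum_univ_five]
  simp
  generalize v 0 = x, v 1 = y, v 2 = z, v 3 = u, v 4 = w
  constructor
  · rintro ⟨h, h1⟩
    obtain rfl : z = 2 - x - y := by linear_combination h1
    exact ⟨by ring, by linear_combination 2 * h⟩
  · rintro ⟨h1, h⟩
    obtain rfl : z = 2 - x - y := by linear_combination h1
    exact ⟨by linear_combination (1 / 2) * h, by ring⟩

theorem varietyII_eq : varietyII = thomaeVariety {0, 1, 3} := by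
  refine eq_thomaeVariety fun v => ?_
  simp only [varietyII, Set.mem_ofPred_eq, thomaeCoord_apply, Fin.sum_univ_five]
  simp
  generalize v 0 = x, v 1 = y, v 2 = z, v 3 = u, v 4 = w
  constructor
  · rintro ⟨h, h1⟩
    obtain rfl : u = 2 - x - y := by linear_combination h1
    exact ⟨by ring, by linear_combination 2 * h⟩
  · rintro ⟨h1, h⟩
    obtain rfl : u = 2 - x - y := by linear_combination h1
    exact ⟨by linear_combination (1 / 2) * h, by ring⟩

theorem varietyIII_eq : varietyIII = thomaeVariety {2, 3, 4} := by
  refine eq_thomaeVariety fun v => ?_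
  simp only [varietyIII, Set.mem_ofPred_eq, thomaeCoord_apply, Fin.sum_univ_five]
  simp
  generalize v 0 = x, v 1 = y, v 2 = z, v 3 = u, v 4 = w
  constructor
  · rintro ⟨h, h1⟩
    obtain rfl : z = 2 - u - w := by linear_combination h1
    exact ⟨by ring, by linear_combination -2 * h⟩
  · rintro ⟨h1, h⟩
    obtain rfl : z = 2 - u - w := by linear_combination h1
    exact ⟨by linear_combination (-1 / 2) * h, by ring⟩

/-- Under permutations preserving `{0, 1, 2}`, a 3-subset is determined by the size of its
intersection with `{0, 1, 2}`; the three representatives have sizes 3, 2 and 1. -/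
theorem exists_map_eq_of_card_eq_three : ∀ S : Finset (Fin 5), S.card = 3 →
    ∃ i : Fin 3, ∃ σ : Equiv.Perm (Fin 5),
      ({0, 1, 2} : Finset (Fin 5)).map σ.toEmbedding = {0, 1, 2} ∧
      (![{0, 1, 2}, {0, 1, 3}, {2, 3, 4}] i : Finset (Fin 5)).map σ.toEmbedding = S := by
  decide +kernel

theorem exists_map_eq : ∀ i : Fin 3, ∃ σ : Equiv.Perm (Fin 5),
      ({0, 1, 2} : Finset (Fin 5)).map σ.toEmbedding =
        (![{0, 1, 2}, {0, 1, 3}, {2, 3, 4}] i : Finset (Fin 5)) := by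
  decide +kernel

theorem varieties_eq (i : Fin 3) : ![varietyI, varietyII, varietyIII] i =
    thomaeVariety (![{0, 1, 2}, {0, 1, 3}, {2, 3, 4}] i) := by
  fin_cases i
  exacts [varietyI_eq, varietyII_eq, varietyIII_eq]

theorem mem_orbit_thomaeGroup_iff {V W : Set (Fin 5 → ℂ)} :
    W ∈ MulAction.orbit thomaeGroup V ↔ ∃ σ, W = thomaeRep σ • V := by
  constructor
  · rintro ⟨⟨_, σ, rfl⟩, rfl⟩
    exact ⟨σ, rfl⟩
  · rintro ⟨σ, rfl⟩
    exact ⟨⟨_, σ, rfl⟩, rfl⟩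

theorem mem_orbit_sepPermGroup_iff {V W : Set (Fin 5 → ℂ)} :
    W ∈ MulAction.orbit sepPermGroup V ↔ ∃ σ : Equiv.Perm (Fin 5),
      ({0, 1, 2} : Finset (Fin 5)).map σ.toEmbedding = {0, 1, 2} ∧ W = permRep σ • V := by
  constructor
  · rintro ⟨⟨_, σ, hσ, rfl⟩, rfl⟩
    exact ⟨σ, mem_stabilizer_iff.mp hσ, rfl⟩
  · rintro ⟨σ, hσ, rfl⟩
    exact ⟨⟨_, σ, mem_stabilizer_iff.mpr hσ, rfl⟩, rfl⟩

theorem varieties_mem_orbit (i : Fin 3) : ![varietyI, varietyII, varietyIII] i ∈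
    MulAction.orbit thomaeGroup slaterVariety := by
  obtain ⟨σ, hσ⟩ := exists_map_eq i
  rw [mem_orbit_thomaeGroup_iff]
  refine ⟨σ, ?_⟩
  rw [varieties_eq, slaterVariety_eq_varietyI, varietyI_eq, thomaeRep_smul_thomaeVariety, hσ]

theorem exists_mem_orbit_sepPermGroup {W : Set (Fin 5 → ℂ)}
    (hW : W ∈ MulAction.orbit thomaeGroup slaterVariety) :
    ∃ i : Fin 3, W ∈ MulAction.orbit sepPermGroup (![varietyI, varietyII, varietyIII] i) := by
  obtain ⟨σ, rfl⟩ := mem_orbit_thomaeGroup_iff.mp hW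
  obtain ⟨i, τ, hτ, hi⟩ := exists_map_eq_of_card_eq_three
    (({0, 1, 2} : Finset (Fin 5)).map σ.toEmbedding) (by rw [Finset.card_map]; rfl)
  refine ⟨i, mem_orbit_sepPermGroup_iff.mpr ⟨τ, hτ, ?_⟩⟩
  rw [varieties_eq, slaterVariety_eq_varietyI, varietyI_eq, thomaeRep_smul_thomaeVariety,
    ← thomaeRep_eq_permRep hτ, thomaeRep_smul_thomaeVariety, hi]

theorem exists_smul_varietyIII_eq {W : Set (Fin 5 → ℂ)}
    (hW : W ∈ MulAction.orbit thomaeGroup slaterVariety) :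
    ∃ e : (Fin 5 → ℂ) ≃ₗ[ℂ] (Fin 5 → ℂ), W = e • varietyIII := by
  have h3 : varietyIII ∈ MulAction.orbit thomaeGroup slaterVariety := varieties_mem_orbit 2
  rw [← MulAction.orbit_eq_iff.mpr h3] at hW
  obtain ⟨σ, rfl⟩ := mem_orbit_thomaeGroup_iff.mp hW
  exact ⟨_, rfl⟩

/-! ### Separate permutations and the gamma quotient summation property. -/

/-- The excess `d + e - a - b - c` in a form that displays its symmetry. -/
theorem excess_eq (v : Fin 5 → ℂ) : v 3 + v 4 - v 0 - v 1 - v 2 =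
    ∑ i, v i - 2 * ∑ i ∈ ({0, 1, 2} : Finset (Fin 5)), v i := by
  simp [Fin.sum_univ_five]
  ring

theorem excess_permRep {σ : Equiv.Perm (Fin 5)}
    (h : ({0, 1, 2} : Finset (Fin 5)).map σ.toEmbedding = {0, 1, 2}) (v : Fin 5 → ℂ) :
    permRep σ v 3 + permRep σ v 4 - permRep σ v 0 - permRep σ v 1 - permRep σ v 2 =
      v 3 + v 4 - v 0 - v 1 - v 2 := by
  have h1 := sum_permRep σ id v
  have h2 := sum_permRep_map σ {0, 1, 2} id v
  rw [h] at h2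
  simp only [id] at h1 h2
  rw [excess_eq, excess_eq, h1, h2]

theorem map_lower_eq {σ : Equiv.Perm (Fin 5)}
    (h : ({0, 1, 2} : Finset (Fin 5)).map σ.toEmbedding = {0, 1, 2}) :
    ({3, 4} : Finset (Fin 5)).map σ.toEmbedding = {3, 4} := by
  have hc : ∀ i : Fin 5, i ∈ ({3, 4} : Finset (Fin 5)) ↔ i ∉ ({0, 1, 2} : Finset (Fin 5)) := by
    decide
  ext i
  rw [Finset.mem_map_equiv, hc, hc]
  exact (mem_map_iff_of_map_eq h i).not

theorem hyp3F2Term_eq_prod (v : Fin 5 → ℂ) (k : ℕ) :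
    hyp3F2Term (v 0) (v 1) (v 2) (v 3) (v 4) k =
      (∏ i ∈ ({0, 1, 2} : Finset (Fin 5)), (ascPochhammer ℂ k).eval (v i)) /
        ((∏ i ∈ ({3, 4} : Finset (Fin 5)), (ascPochhammer ℂ k).eval (v i)) * k.factorial) := by
  simp [hyp3F2Term, mul_assoc]

theorem prod_permRep_of_map_eq {σ : Equiv.Perm (Fin 5)} {S : Finset (Fin 5)}
    (h : S.map σ.toEmbedding = S) (f : ℂ → ℂ) (v : Fin 5 → ℂ) :
    ∏ j ∈ S, f (permRep σ v j) = ∏ j ∈ S, f (v j) := by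
  conv_lhs => rw [← h]
  simp [permRep_apply]

theorem hyp3F2Term_permRep {σ : Equiv.Perm (Fin 5)}
    (h : ({0, 1, 2} : Finset (Fin 5)).map σ.toEmbedding = {0, 1, 2}) (v : Fin 5 → ℂ) :
    hyp3F2Term (permRep σ v 0) (permRep σ v 1) (permRep σ v 2) (permRep σ v 3) (permRep σ v 4) =
      hyp3F2Term (v 0) (v 1) (v 2) (v 3) (v 4) := by
  ext k
  rw [hyp3F2Term_eq_prod, hyp3F2Term_eq_prod,
    prod_permRep_of_map_eq h (fun z => (ascPochhammer ℂ k).eval z),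
    prod_permRep_of_map_eq (map_lower_eq h) (fun z => (ascPochhammer ℂ k).eval z)]

theorem admissible_iff (v : Fin 5 → ℂ) : Admissible v ↔
    (∀ i ∈ ({3, 4} : Finset (Fin 5)), NotNonposInt (v i)) ∧
      0 < (v 3 + v 4 - v 0 - v 1 - v 2).re := by
  simp [Admissible, and_assoc]

theorem Admissible.of_permRep {σ : Equiv.Perm (Fin 5)}
    (h : ({0, 1, 2} : Finset (Fin 5)).map σ.toEmbedding = {0, 1, 2}) {v : Fin 5 → ℂ}
    (hv : Admissible (permRep σ v)) : Admissible v := by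
  rw [admissible_iff, excess_permRep h] at hv
  rw [admissible_iff]
  refine ⟨fun i hi => ?_, hv.2⟩
  have := hv.1 (σ i) (by
    rw [← map_lower_eq h]
    exact Finset.mem_map_of_mem σ.toEmbedding hi)
  simpa [permRep_apply] using this

/-- The affine function `v ↦ f (σ⁻¹ v)`. -/
def RatAffine.perm (σ : Equiv.Perm (Fin 5)) (f : RatAffine) : RatAffine := (f.1 ∘ ⇑σ⁻¹, f.2)

theorem RatAffine.eval_perm (σ : Equiv.Perm (Fin 5)) (f : RatAffine) (v : Fin 5 → ℂ) :
    (f.perm σ).eval (permRep σ v) = f.eval v := by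
  simp only [RatAffine.eval, RatAffine.perm, permRep_apply, Function.comp_apply]
  rw [Equiv.sum_comp σ⁻¹ fun i => (f.1 i : ℂ) * v i]

/-- The series and admissibility are symmetric in the upper and in the lower parameters, so only the
affine arguments of the gamma functions have to be permuted. -/
theorem HasGammaQuotientSummation.permRep_smul {σ : Equiv.Perm (Fin 5)}
    (h : ({0, 1, 2} : Finset (Fin 5)).map σ.toEmbedding = {0, 1, 2}) {V : Set (Fin 5 → ℂ)}
    (hV : HasGammaQuotientSummation V) : HasGammaQuotientSummation (permRep σ • V) := by
  obtain ⟨num, den, hnd⟩ := hV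
  refine ⟨num.map (RatAffine.perm σ), den.map (RatAffine.perm σ), ?_⟩
  rintro _ ⟨v, hv, rfl⟩ hadm
  obtain ⟨hnum, hsum⟩ := hnd v hv (hadm.of_permRep h)
  change _ ∧ HasSum (hyp3F2Term (permRep σ v 0) (permRep σ v 1) (permRep σ v 2) (permRep σ v 3)
    (permRep σ v 4)) _
  rw [hyp3F2Term_permRep h]
  have heval : ∀ f : RatAffine, (f.perm σ).eval ((fun x => permRep σ • x) v) = f.eval v :=
    fun f => f.eval_perm σ v
  simp only [List.map_map, Function.comp_def, List.forall_mem_map, heval]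
  exact ⟨hnum, hsum⟩

theorem varietyI_hasGammaQuotientSummation : HasGammaQuotientSummation varietyI := by
  refine ⟨[(![0, 0, 0, 1, 0], 0), (![0, 0, 0, 0, 1], 0)],
    [(![1, 0, 0, 0, 0], 1), (![0, 1, 0, 0, 0], 1), (![0, 0, 1, 0, 0], 1)], ?_⟩
  rintro v ⟨h, h1⟩ ⟨hd, he, -⟩
  have := hasSum_hyp3F2Term_of_slater h h1 hd he
  simpa [RatAffine.eval, Fin.sum_univ_five, hd, he] using this

theorem varietyII_hasGammaQuotientSummation : HasGammaQuotientSummation varietyII := by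
  refine ⟨[(![0, 0, 0, 0, 1], 0), (![-1, -1, 0, 0, 1], 2), (![0, 0, 1, 0, 0], 2)],
    [(![-1, 0, 0, 0, 1], 1), (![0, -1, 0, 0, 1], 1), (![0, 0, 1, 0, 0], 1)], ?_⟩
  rintro v ⟨h, h1⟩ ⟨hd, he, hs⟩
  rw [h1] at hd hs ⊢
  have hs' : 0 < (v 4 - v 0 - v 1 + 2).re := by convert hs using 2; ring
  have h2 := NotNonposInt.of_re_pos hs'
  have := hasSum_hyp3F2Term_add_two h hs' hd he
  have e1 : -v 0 + -v 1 + v 4 + 2 = v 4 - v 0 - v 1 + 2 := by ring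
  have e2 : -v 0 + v 4 + 1 = v 4 - v 0 + 1 := by ring
  have e3 : -v 1 + v 4 + 1 = v 4 - v 1 + 1 := by ring
  simpa [RatAffine.eval, Fin.sum_univ_five, hd, he, e1, e2, e3, h2] using this

/-- Where `d` and `e` are not poles of the gamma function, the third sum is a gamma quotient. -/
theorem gammaQuotient_varietyIII {d e s : ℂ} (hd : NotNonposInt d) (he : NotNonposInt e)
    (hs : 0 < s.re) :
    gammaQuotient [d, e, s] [d - 1, e - 1, s + 1] = (d - 1) * (e - 1) / s := by
  have hlow : ∀ {z : ℂ}, NotNonposInt z →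
      Complex.Gamma z / Complex.Gamma (z - 1) = z - 1 := by
    intro z hz
    -- At `z = 1` both sides are 0, again because `Complex.Gamma 0 = 0`.
    by_cases hz0 : z - 1 = 0
    · simp [hz0]
    have hz1 : NotNonposInt (z - 1) := by
      rintro (_ | n) hn
      · exact hz0 (by simpa using hn)
      · exact hz n (by push_cast at hn; linear_combination hn)
    have := Complex.Gamma_add_one _ hz0
    rw [sub_add_cancel] at this
    rw [this, mul_div_cancel_right₀ _ hz1.Gamma_ne_zero]
  have hs' := NotNonposInt.of_re_pos hs
  have hs0 : s ≠ 0 := by simpa using hs' 0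
  have hup : Complex.Gamma s / Complex.Gamma (s + 1) = 1 / s := by
    rw [Complex.Gamma_add_one _ hs0]
    have := hs'.Gamma_ne_zero
    field_simp
  simp only [gammaQuotient, List.map_cons, List.map_nil, List.prod_cons, List.prod_nil, mul_one]
  rw [mul_div_mul_comm, mul_div_mul_comm, hlow hd, hlow he, hup]
  ring

theorem varietyIII_hasGammaQuotientSummation : HasGammaQuotientSummation varietyIII := by
  refine ⟨[(![0, 0, 0, 1, 0], 0), (![0, 0, 0, 0, 1], 0), (![-1, -1, 0, 1, 1], -2)],
    [(![0, 0, 0, 1, 0], -1), (![0, 0, 0, 0, 1], -1), (![-1, -1, 0, 1, 1], -1)], ?_⟩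
  rintro v ⟨h, h1⟩ ⟨hd, he, hs⟩
  rw [h1] at hs ⊢
  have h2 := NotNonposInt.of_re_pos hs
  have := hasSum_hyp3F2Term_two h hs hd he
  rw [← gammaQuotient_varietyIII hd he hs] at this
  have e1 : -v 0 - v 1 + v 3 + v 4 - 2 = v 3 + v 4 - v 0 - v 1 - 2 := by ring
  have e2 : -v 0 - v 1 + v 3 + v 4 - 1 = v 3 + v 4 - v 0 - v 1 - 2 + 1 := by ring
  simpa [RatAffine.eval, Fin.sum_univ_five, hd, he, e1, e2, h2, ← sub_eq_add_neg] using this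

theorem varieties_hasGammaQuotientSummation (i : Fin 3) :
    HasGammaQuotientSummation (![varietyI, varietyII, varietyIII] i) := by
  fin_cases i
  exacts [varietyI_hasGammaQuotientSummation, varietyII_hasGammaQuotientSummation,
    varietyIII_hasGammaQuotientSummation]

/-! ### Inequivalence of the three varieties under separate permutations. -/

/-- Constancy of the excess at 2 is the invariant that singles out `varietyI`. -/
theorem excess_eq_two_iff {σ : Equiv.Perm (Fin 5)}
    (h : ({0, 1, 2} : Finset (Fin 5)).map σ.toEmbedding = {0, 1, 2}) (V : Set (Fin 5 → ℂ)) :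
    (∀ v ∈ permRep σ • V, v 3 + v 4 - v 0 - v 1 - v 2 = 2) ↔
      ∀ v ∈ V, v 3 + v 4 - v 0 - v 1 - v 2 = 2 := by
  rw [← Set.image_smul, Set.forall_mem_image]
  exact forall₂_congr fun v _ => by rw [← excess_permRep h v]; rfl

/-- A separate permutation may move the constant upper parameter, hence the existential form. This
invariant separates `varietyIII` from `varietyII`. -/
theorem exists_upper_eq_two_iff {σ : Equiv.Perm (Fin 5)}
    (h : ({0, 1, 2} : Finset (Fin 5)).map σ.toEmbedding = {0, 1, 2}) (V : Set (Fin 5 → ℂ)) :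
    (∃ i ∈ ({0, 1, 2} : Finset (Fin 5)), ∀ v ∈ permRep σ • V, v i = 2) ↔
      ∃ i ∈ ({0, 1, 2} : Finset (Fin 5)), ∀ v ∈ V, v i = 2 := by
  have : ∀ i, (∀ v ∈ permRep σ • V, v i = 2) ↔ ∀ v ∈ V, v (σ⁻¹ i) = 2 := by
    intro i
    rw [← Set.image_smul, Set.forall_mem_image]
    rfl
  simp only [this]
  constructor
  · rintro ⟨i, hi, hV⟩
    exact ⟨σ⁻¹ i, (mem_map_iff_of_map_eq h i).mpr hi, hV⟩
  · rintro ⟨i, hi, hV⟩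
    refine ⟨σ i, (mem_map_iff_of_map_eq h _).mp (by simpa using hi), by simpa using hV⟩

theorem varieties_excess_eq_two_iff (i : Fin 3) :
    (∀ v ∈ ![varietyI, varietyII, varietyIII] i, v 3 + v 4 - v 0 - v 1 - v 2 = 2) ↔ i = 0 := by
  fin_cases i
  · simpa using fun v (hv : v ∈ varietyI) => hv.2
  · refine iff_of_false (fun h => ?_) (by decide)
    have := h ![1, 0, 0, 2, 5] (by simp [varietyII])
    simp only [Matrix.cons_val] at this
    norm_num at this
  · refine iff_of_false (fun h => ?_) (by decide)
    have := h ![1, 0, 2, 2, 5] (by simp [varietyIII])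
    simp only [Matrix.cons_val] at this
    norm_num at this

theorem not_varietyII_upper_eq_two :
    ¬ ∃ i ∈ ({0, 1, 2} : Finset (Fin 5)), ∀ v ∈ varietyII, v i = 2 := by
  rintro ⟨i, hi, h⟩
  have := h ![1, 0, 0, 2, 5] (by simp [varietyII])
  simp only [Finset.mem_insert, Finset.mem_singleton] at hi
  rcases hi with rfl | rfl | rfl <;>
    simp only [Matrix.cons_val] at this <;> norm_num at this

theorem eq_of_mem_orbit_sepPermGroup {W : Set (Fin 5 → ℂ)} {i j : Fin 3}
    (hi : W ∈ MulAction.orbit sepPermGroup (![varietyI, varietyII, varietyIII] i))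
    (hj : W ∈ MulAction.orbit sepPermGroup (![varietyI, varietyII, varietyIII] j)) : i = j := by
  obtain ⟨σ, hσ, rfl⟩ := mem_orbit_sepPermGroup_iff.mp hi
  obtain ⟨τ, hτ, h⟩ := mem_orbit_sepPermGroup_iff.mp hj
  have h0 : i = 0 ↔ j = 0 := by
    rw [← varieties_excess_eq_two_iff i, ← varieties_excess_eq_two_iff j,
      ← excess_eq_two_iff hσ, h, excess_eq_two_iff hτ]
  have h2 := exists_upper_eq_two_iff hσ (![varietyI, varietyII, varietyIII] i)
  rw [h, exists_upper_eq_two_iff hτ] at h2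
  have hIII : ∃ i ∈ ({0, 1, 2} : Finset (Fin 5)), ∀ v ∈ varietyIII, v i = 2 :=
    ⟨2, by decide, fun v hv => hv.2⟩
  have hII := not_varietyII_upper_eq_two
  fin_cases i <;> fin_cases j <;> first | rfl | exact absurd h0 (by decide) | skip
  · exact absurd (h2.mp hIII) hII
  · exact absurd (h2.mpr hIII) hII

theorem mainTheorem6 :
    -- the Slater variety is the variety of the first identity
    slaterVariety = varietyI ∧
    -- every variety on its orbit is 3-dimensional, is not a 3-plane, and has the property
    (∀ W ∈ MulAction.orbit thomaeGroup slaterVariety,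
      IsVarietyOfDim W 3 ∧ ¬ IsPlaneOfDim W 3 ∧ HasGammaQuotientSummation W) ∧
    -- up to separate permutations, the orbit comprises exactly the three varieties
    (∀ i : Fin 3, ![varietyI, varietyII, varietyIII] i ∈
      MulAction.orbit thomaeGroup slaterVariety) ∧
    (∀ W ∈ MulAction.orbit thomaeGroup slaterVariety,
      ∃! i : Fin 3, W ∈ MulAction.orbit sepPermGroup (![varietyI, varietyII, varietyIII] i)) ∧
    -- the first identity
    (∀ a b c d e : ℂ, a * b + b * c + c * a = (d - 1) * (e - 1) → d + e - a - b - c = 2 →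
      NotNonposInt d → NotNonposInt e →
      HasSum (hyp3F2Term a b c d e) (gammaQuotient [d, e] [a + 1, b + 1, c + 1])) ∧
    -- the second identity
    (∀ a b c e : ℂ, (a - 1) * (b - 1) = ((a - 1) + (b - 1) - (e - 1)) * c →
      0 < (e - a - b + 2).re → NotNonposInt (c + 2) → NotNonposInt e →
      HasSum (hyp3F2Term a b c (c + 2) e)
        (gammaQuotient [e, e - a - b + 2, c + 2] [e - a + 1, e - b + 1, c + 1])) ∧
    -- the third identity
    (∀ a b d e : ℂ, (a - 1) * (b - 1) = (d - 2) * (e - 2) →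
      0 < (d + e - a - b - 2).re → NotNonposInt d → NotNonposInt e →
      HasSum (hyp3F2Term a b 2 d e) ((d - 1) * (e - 1) / (d + e - a - b - 2))) := by
  refine ⟨slaterVariety_eq_varietyI, fun W hW => ?_, varieties_mem_orbit, fun W hW => ?_,
    fun a b c d e => hasSum_hyp3F2Term_of_slater, fun a b c e => hasSum_hyp3F2Term_add_two,
    fun a b d e => hasSum_hyp3F2Term_two⟩
  · obtain ⟨e, he⟩ := exists_smul_varietyIII_eq hW
    obtain ⟨i, hi⟩ := exists_mem_orbit_sepPermGroup hW
    obtain ⟨σ, hσ, hWi⟩ := mem_orbit_sepPermGroup_iff.mp hi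
    refine ⟨?_, ?_, ?_⟩
    · rw [he]
      exact varietyIII_isVarietyOfDim.smul e
    · rw [he]
      exact not_isPlaneOfDim_smul_varietyIII e 3
    · rw [hWi]
      exact (varieties_hasGammaQuotientSummation i).permRep_smul hσ
  · obtain ⟨i, hi⟩ := exists_mem_orbit_sepPermGroup hW
    exact ⟨i, hi, fun j hj => eq_of_mem_orbit_sepPermGroup hj hi⟩

end
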